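/- Let $E$ and $F$ be finite directed graphs (loops and parallel edges allowed) that are essential, i.e. have no sources and no sinks, and let $A_E$, $A_F$ be their adjacency matrices, where $A_E(v,w)$ is the number of edges from $v$ to $w$. Suppose that $A_E$ and $A_F$ are shift equivalent: there are an integer $\ell\ge 1$ and matrices $R,S$ with nonnegative integer entries such that $A_E^{\ell}=RS$, $A_F^{\ell}=SR$, $A_ER=RA_F$ and $SA_E=A_FS$. A path $e_1\cdots e_n$ with $n\ge 1$ is a cycle based at $v$ if it starts and ends at $v$ and the sources of $e_1,\dots,e_n$ are distinct. A graph has disjoint cycles if each of its vertices is the base of at most one cycle. Let $\mathcal C_E$ be the set of cycles of $E$, where cycles that differ only in the choice of the base vertex (cyclic rotation of the edges) are identified. For $c,c'\in\mathcal C_E$ write $c\le c'$ if there is a path (possibly of length $0$) from a vertex on $c'$ to a vertex on $c$, and let $|c|$ be the length of $c$. The relation $\le$ is a preorder, and a partial order if $E$ has disjoint cycles. Then $E$ has disjoint cycles if and only if $F$ has disjoint cycles. In this case there is an isomorphism of partially ordered sets $\phi\colon\mathcal C_E\to\mathcal C_F$ (a bijection with $c\le c'\iff\phi(c)\le\phi(c')$)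 such that $|\phi(c)|=|c|$ for all $c\in\mathcal C_E$. -/

import Mathlib

/-! A directed graph with vertex type `V` is a `Quiver V` (parallel edges and loops allowed); an
edge from `v` to `w` is an element of `v ⟶ w`, and a path is a `Quiver.Path`, vertices being the
paths of length zero. -/

namespace GraphCycles

universe u v

section Matrices

/-- Shift equivalence of square matrices over the nonnegative integers. -/
def ShiftEquivalent {m n : Type*} [Fintype m] [DecidableEq m] [Fintype n] [DecidableEq n]
    (A : Matrix m m ℕ) (B : Matrix n n ℕ) : Prop :=
  ∃ l : ℕ, 1 ≤ l ∧ ∃ (R : Matrix m n ℕ) (S : Matrix n m ℕ),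
    A ^ l = R * S ∧ B ^ l = S * R ∧ A * R = R * B ∧ S * A = B * S

/-- The adjacency matrix: the entry at `(v, w)` is the number of edges from `v` to `w`. -/
def adjMatrix (V : Type u) [Quiver.{v} V] [∀ a b : V, Fintype (a ⟶ b)] : Matrix V V ℕ :=
  Matrix.of fun a b => Fintype.card (a ⟶ b)

end Matrices

/-- The graph has no sinks and no sources. -/
def IsEssential (V : Type u) [Quiver.{v} V] : Prop :=
  (∀ a : V, ∃ b : V, Nonempty (a ⟶ b)) ∧ (∀ b : V, ∃ a : V, Nonempty (a ⟶ b))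

section Cycles

variable {V : Type u} [Quiver.{v} V]

/-- The string of edges `e₁ ⋯ eₙ` of a path; `Quiver.Total V` is the type of all edges. -/
def edgeList {a : V} : ∀ {b : V}, Quiver.Path a b → List (Quiver.Total V)
  | _, Quiver.Path.nil => []
  | _, Quiver.Path.cons p e => edgeList p ++ [⟨_, _, e⟩]

/-- A closed path of positive length is a cycle if the sources of its edges are distinct. -/
def IsCyclePath {a : V} (p : Quiver.Path a a) : Prop :=
  0 < p.length ∧ ((edgeList p).map Quiver.Total.left).Nodup

variable (V) in
/-- Every vertex is the base of at most one cycle. -/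
def HasDisjointCycles : Prop :=
  ∀ (a : V) (p q : Quiver.Path a a), IsCyclePath p → IsCyclePath q → p = q

variable (V) in
/-- A cycle together with the vertex at which it is based. -/
structure BasedCycle where
  base : V
  path : Quiver.Path base base
  isCycle : IsCyclePath path

/-- Based cycles are identified when their strings of edges are rotations of each other, that is,
when they are the same cycle read from different base vertices. -/
instance basedCycleSetoid : Setoid (BasedCycle V) :=
  (List.IsRotated.setoid (Quiver.Total V)).comap fun c => edgeList c.path

variable (V) in
/-- The set of distinct cycles of the graph. -/
def CycleSet : Type (max u v) := Quotient (basedCycleSetoid (V := V))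

theorem length_edgeList {a b : V} (p : Quiver.Path a b) : (edgeList p).length = p.length := by
  induction p with
  | nil => rfl
  | cons p e ih => simp [edgeList, ih]

theorem path_of_mem_edgeList {a b : V} (p : Quiver.Path a b) (e : Quiver.Total V)
    (he : e ∈ edgeList p) :
    Nonempty (Quiver.Path a e.left) ∧ Nonempty (Quiver.Path e.right b) := by
  induction p with
  | nil => simp [edgeList] at he
  | cons p f ih =>
    simp only [edgeList, List.mem_append, List.mem_singleton] at he
    rcases he with he | rfl
    · obtain ⟨h₁, ⟨h₂⟩⟩ := ih he
      exact ⟨h₁, ⟨h₂.cons f⟩⟩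
    · exact ⟨⟨p⟩, ⟨Quiver.Path.nil⟩⟩

/-- The length of a cycle. -/
def CycleSet.length : CycleSet V → ℕ :=
  Quotient.lift (fun c : BasedCycle V => c.path.length) fun c d h => by
    rw [← length_edgeList, ← length_edgeList]
    exact List.Perm.length_eq (List.IsRotated.perm h)

/-- The set of vertices lying on a cycle: the sources and the ranges of its edges. -/
def CycleSet.support : CycleSet V → Set V :=
  Quotient.lift
    (fun c : BasedCycle V => {w | ∃ e ∈ edgeList c.path, w = e.left ∨ w = e.right})
    fun c d h => by
      ext w
      have key : ∀ e, e ∈ edgeList c.path ↔ e ∈ edgeList d.path :=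
        fun e => List.IsRotated.mem_iff h
      simp only [Set.mem_ofPred_eq, key]

theorem CycleSet.support_nonempty (c : CycleSet V) : c.support.Nonempty := by
  induction c using Quotient.inductionOn with
  | h c =>
    have h : 0 < (edgeList c.path).length := by
      rw [length_edgeList]; exact c.isCycle.1
    obtain ⟨e, he⟩ := List.exists_mem_of_length_pos h
    exact ⟨e.left, e, he, Or.inl rfl⟩

theorem CycleSet.path_of_mem_support (c : CycleSet V) {x y : V} (hx : x ∈ c.support)
    (hy : y ∈ c.support) : Nonempty (Quiver.Path x y) := by
  induction c using Quotient.inductionOn with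
  | h c =>
    have key : ∀ z, (∃ e ∈ edgeList c.path, z = e.left ∨ z = e.right) →
        Nonempty (Quiver.Path c.base z) ∧ Nonempty (Quiver.Path z c.base) := by
      rintro z ⟨e, he, hz⟩
      obtain ⟨⟨p⟩, ⟨q⟩⟩ := path_of_mem_edgeList c.path e he
      rcases hz with rfl | rfl
      · exact ⟨⟨p⟩, ⟨e.hom.toPath.comp q⟩⟩
      · exact ⟨⟨p.cons e.hom⟩, ⟨q⟩⟩
    obtain ⟨-, ⟨p⟩⟩ := key x hx
    obtain ⟨⟨q⟩, -⟩ := key y hy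
    exact ⟨p.comp q⟩

/-- The preorder on cycles: `c ≤ c'` if some path starts at a vertex on `c'` and ends at a vertex
on `c`. -/
instance : Preorder (CycleSet V) where
  le c c' := ∃ w ∈ c.support, ∃ w' ∈ c'.support, Nonempty (Quiver.Path w' w)
  le_refl c := by
    obtain ⟨w, hw⟩ := c.support_nonempty
    exact ⟨w, hw, w, hw, ⟨Quiver.Path.nil⟩⟩
  le_trans := by
    rintro c d e ⟨w, hw, x, hx, ⟨p⟩⟩ ⟨y, hy, z, hz, ⟨q⟩⟩
    obtain ⟨r⟩ := d.path_of_mem_support hy hx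
    exact ⟨w, hw, z, hz, ⟨(q.comp r).comp p⟩⟩

end Cycles

end GraphCycles

namespace GraphCycles

universe u v u' v'

/-! ### Paths and closed paths as lists of edges -/

section Paths

open Quiver

variable {V : Type u} [Quiver.{v} V]

/-! Cycles are disjoint iff no vertex bases two closed paths of equal length, that is, iff all
powers of the adjacency matrix have diagonal entries at most 1
(`hasDisjointCycles_iff_adjMatrix_pow_le_one`). A larger diagonal entry makes return counts grow
exponentially along some powers, whereas `A ^ N = R * B ^ (N - l) * S` keeps them bounded when `B`
has small diagonals; so the condition transfers (`diag_le_one`).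

For the bijection, `R` and `S` link vertices of the two graphs so that paths between vertices give
paths between linked ones (`pow_pos_of_pow_pos`). Strongly connected components carrying cycles thus
correspond, with reachability preserved, and under disjointness each consists of a single cycle.
Transport shifts path lengths by a constant, so comparing the empty path with a cycle yields
divisibility of lengths both ways (`IsShiftEquivalence.length_dvd`). -/

theorem edgeList_comp {a b c : V} (p : Path a b) (q : Path b c) :
    edgeList (p.comp q) = edgeList p ++ edgeList q := by
  induction q with
  | nil => simp [edgeList]
  | cons q e ih => simp [edgeList, ih]

theorem edgeList_injective {a b : V} :
    Function.Injective (edgeList : Path a b → List (Total V)) := by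
  intro p q h
  induction p with
  | nil =>
    have hq : q.length = 0 := by rw [← length_edgeList, ← h]; rfl
    exact (Path.eq_nil_of_length_zero q hq).symm
  | cons p e ih =>
    cases q with
    | nil => simp [edgeList] at h
    | cons q f =>
      obtain ⟨h₁, h₂⟩ := List.append_inj' h rfl
      cases h₂
      rw [ih h₁]

theorem exists_edgeList_eq_cons {a b : V} (p : Path a b) (hp : 0 < p.length) :
    ∃ (e : Total V) (l : List (Total V)), edgeList p = e :: l ∧ e.left = a := by
  obtain ⟨n, hn⟩ := Nat.exists_eq_add_of_lt hp
  obtain ⟨c, f, q, -, rfl⟩ := p.eq_toPath_comp_of_length_eq_succ (n := n) (by omega)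
  exact ⟨⟨a, c, f⟩, edgeList q, by rw [edgeList_comp]; rfl, rfl⟩

/-- A path through an edge splits there. -/
theorem exists_edgeList_eq_of_mem {a b : V} (p : Path a b) {e : Total V} (he : e ∈ edgeList p) :
    ∃ (q : Path a e.left) (r : Path e.right b),
      edgeList p = edgeList q ++ e :: edgeList r := by
  induction p with
  | nil => simp [edgeList] at he
  | cons p f ih =>
    simp only [edgeList, List.mem_append, List.mem_singleton] at he
    rcases he with he | rfl
    · obtain ⟨q, r, h⟩ := ih he
      exact ⟨q, r.cons f, by simp [edgeList, h]⟩
    · exact ⟨p, Path.nil, by simp [edgeList]⟩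

/-- The final segment of prescribed length. -/
theorem exists_eq_comp_of_le_length {a b : V} (p : Path a b) (n : ℕ) (hn : n ≤ p.length) :
    ∃ (c : V) (q : Path a c) (r : Path c b), p = q.comp r ∧ r.length = n := by
  induction p generalizing n with
  | nil => exact ⟨_, Path.nil, Path.nil, rfl, (Nat.le_zero.1 hn).symm⟩
  | cons p e ih =>
    cases n with
    | zero => exact ⟨_, p.cons e, Path.nil, rfl, rfl⟩
    | succ n =>
      obtain ⟨c, q, r, rfl, hr⟩ := ih n (by simpa using hn)
      exact ⟨c, q, r.cons e, rfl, by simp [hr]⟩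

/-- The vertices of a path, in order. -/
def vertexList {a b : V} (p : Path a b) : List V := (edgeList p).map Total.left ++ [b]

theorem exists_prefix_of_mem_vertexList {a b : V} (p : Path a b) {x : V}
    (hx : x ∈ vertexList p) : ∃ q : Path a x, vertexList q <+: vertexList p := by
  induction p with
  | nil =>
    obtain rfl : x = a := by simpa [vertexList, edgeList] using hx
    exact ⟨Path.nil, List.prefix_rfl⟩
  | @cons b c p e ih =>
    have key : vertexList (p.cons e) = vertexList p ++ [c] := by
      simp only [vertexList, edgeList, List.map_append, List.map_cons, List.map_nil]
    rw [key, List.mem_append, List.mem_singleton] at hx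
    rcases hx with hx | rfl
    · obtain ⟨q, hq⟩ := ih hx
      exact ⟨q, hq.trans (key ▸ List.prefix_append _ _)⟩
    · exact ⟨p.cons e, List.prefix_rfl⟩

theorem exists_nodup_vertexList {a b : V} (p : Path a b) :
    ∃ q : Path a b, (vertexList q).Nodup := by
  induction p with
  | nil => exact ⟨Path.nil, by simp [vertexList, edgeList]⟩
  | @cons b c p e ih =>
    obtain ⟨q, hq⟩ := ih
    by_cases hc : c ∈ vertexList q
    · obtain ⟨r, hr⟩ := exists_prefix_of_mem_vertexList q hc
      exact ⟨r, hr.sublist.nodup hq⟩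
    · refine ⟨q.cons e, ?_⟩
      have key : vertexList (q.cons e) = vertexList q ++ [c] := by
        simp only [vertexList, edgeList, List.map_append, List.map_cons, List.map_nil]
      rw [key]
      exact List.nodup_append.2 ⟨hq, by simp, by rintro x hx y hy rfl; simp_all⟩

/-- An edge whose range leads back to its source is the last edge of a cycle. -/
theorem exists_isCyclePath_cons {a b : V} (p : Path b a) (e : a ⟶ b) :
    ∃ q : Path b a, IsCyclePath (q.cons e) := by
  obtain ⟨q, hq⟩ := exists_nodup_vertexList p
  exact ⟨q, by simp, by simpa [vertexList, edgeList] using hq⟩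

theorem exists_basedCycle {a : V} (p : Path a a) (hp : 0 < p.length) :
    ∃ c : BasedCycle V, c.base = a := by
  cases p with
  | nil => simp at hp
  | cons p e =>
    obtain ⟨q, hq⟩ := exists_isCyclePath_cons p e
    exact ⟨⟨a, _, hq⟩, rfl⟩

/-- A closed path commuting with a cycle is no shorter than it. -/
theorem IsCyclePath.length_le_of_comp_eq {a : V} {p q : Path a a} (hq : IsCyclePath q)
    (hp : 0 < p.length) (h : p.comp q = q.comp p) : q.length ≤ p.length := by
  by_contra! hlt
  have hl := congrArg edgeList h
  rw [edgeList_comp, edgeList_comp] at hl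
  obtain ⟨t, ht⟩ : edgeList p <+: edgeList q :=
    List.prefix_of_prefix_length_le (List.prefix_append _ _) (hl.symm ▸ List.prefix_append (edgeList q) (edgeList p))
      (by rw [length_edgeList, length_edgeList]; exact hlt.le)
  -- Now `q` reads both `p t` and `t p`. If `t` is nonempty, then `p` and `t` both begin with an
  -- edge of source `a`, which `p t` repeats.
  have ht' : edgeList q = t ++ edgeList p := by
    rw [← ht, List.append_assoc, List.append_cancel_left_eq, ht] at hl
    exact hl
  obtain ⟨x, l, hx, hxa⟩ := exists_edgeList_eq_cons p hp
  obtain ⟨y, m, hy, hya⟩ := exists_edgeList_eq_cons q hq.1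
  cases t with
  | nil =>
    have := congrArg List.length ht
    simp only [List.append_nil, length_edgeList] at this
    omega
  | cons z t =>
    have hz : z = y := by
      rw [hy] at ht'
      simpa using (List.cons.inj ht').1.symm
    have hn := hq.2
    rw [← ht, hx, hz] at hn
    simp [hxa, hya] at hn

/-! ### Rigidity of paths when cycles are disjoint -/

namespace HasDisjointCycles

/-- Each edge closes up to a cycle based at `c` and ending with that edge; these two cycles
coincide. -/
theorem edge_eq (hV : HasDisjointCycles V) {a b c : V} (e : a ⟶ c) (f : b ⟶ c)
    (p : Path c a) (q : Path c b) : (⟨a, c, e⟩ : Total V) = ⟨b, c, f⟩ := by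
  obtain ⟨p', hp⟩ := exists_isCyclePath_cons p e
  obtain ⟨q', hq⟩ := exists_isCyclePath_cons q f
  have h : edgeList p' ++ [(⟨a, c, e⟩ : Total V)] = edgeList q' ++ [⟨b, c, f⟩] :=
    congrArg edgeList (hV c _ _ hp hq)
  simpa using (List.append_inj' h rfl).2

/-- Paths with a common end inside a strongly connected component are determined by their
length. -/
theorem edgeList_eq (hV : HasDisjointCycles V) {a b c : V} (p : Path a c) (q : Path b c)
    (h : p.length = q.length) (r : Path c a) (s : Path c b) :
    a = b ∧ edgeList p = edgeList q := by
  induction p with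
  | nil =>
    cases q with
    | nil => exact ⟨rfl, rfl⟩
    | cons q f => simp at h
  | cons p e ih =>
    cases q with
    | nil => simp at h
    | cons q f =>
      have hef := hV.edge_eq e f (r.comp p) (s.comp q)
      cases hef
      obtain ⟨rfl, hpq⟩ := ih q (by simpa using h) (e.toPath.comp r) (e.toPath.comp s)
      exact ⟨rfl, by simp [edgeList, hpq]⟩

theorem path_eq (hV : HasDisjointCycles V) {a : V} {p q : Path a a}
    (h : p.length = q.length) : p = q :=
  edgeList_injective (hV.edgeList_eq p q h Path.nil Path.nil).2

end HasDisjointCycles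

/-- For the converse, `p.comp q` and `q.comp p` have equal length, so two cycles at one base commute
and neither is longer than the other. -/
theorem hasDisjointCycles_iff :
    HasDisjointCycles V ↔ ∀ (a : V) (p q : Path a a), p.length = q.length → p = q := by
  refine ⟨fun h a p q => h.path_eq, fun h a p q hp hq => h a p q ?_⟩
  have hc : p.comp q = q.comp p := h a _ _ (by simp [add_comm])
  exact le_antisymm (hp.length_le_of_comp_eq hq.1 hc.symm) (hq.length_le_of_comp_eq hp.1 hc)

/-- The final segment of length `c.length` has the same edges as `c`, so removing it leaves a
shorter closed path at `a`. -/
theorem HasDisjointCycles.length_dvd (hV : HasDisjointCycles V) {a : V} {c : Path a a}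
    (hc : IsCyclePath c) (p : Path a a) : c.length ∣ p.length := by
  induction hn : p.length using Nat.strong_induction_on generalizing p with
  | _ n ih =>
    rcases Nat.eq_zero_or_pos n with rfl | hpos
    · exact dvd_zero _
    have hle : c.length ≤ p.length :=
      hc.length_le_of_comp_eq (hn ▸ hpos) (hV.path_eq (by simp [add_comm]))
    obtain ⟨b, q, r, rfl, hr⟩ := exists_eq_comp_of_le_length p _ hle
    obtain ⟨rfl, -⟩ := hV.edgeList_eq r c hr q Path.nil
    have hlen := Path.length_comp q r
    have h := ih q.length (by have := hc.1; omega) q rfl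
    rw [← hn, hlen, hr]
    exact dvd_add h dvd_rfl

/-! ### Change of base vertex and cycle classes -/

namespace BasedCycle

/-- The cycle without its base vertex. -/
def toCycleSet (c : BasedCycle V) : CycleSet V := Quotient.mk _ c

/-- A cycle may be based at the source of any of its edges. -/
theorem exists_rotation (c : BasedCycle V) {e : Total V} (he : e ∈ edgeList c.path) :
    ∃ d : BasedCycle V, d.base = e.left ∧ d ≈ c := by
  obtain ⟨q, r, h⟩ := exists_edgeList_eq_of_mem c.path he
  have hl : edgeList ((e.hom.toPath.comp r).comp q) = (e :: edgeList r) ++ edgeList q := by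
    rw [edgeList_comp, edgeList_comp]; rfl
  have hrot : edgeList ((e.hom.toPath.comp r).comp q) ~r edgeList c.path := by
    rw [hl, h]
    exact List.isRotated_append
  refine ⟨⟨e.left, _, ?_, ?_⟩, rfl, hrot⟩
  · rw [← length_edgeList, hl]; simp
  · exact (hrot.perm.map _).nodup_iff.2 c.isCycle.2

theorem base_mem_support (c : BasedCycle V) : c.base ∈ c.toCycleSet.support := by
  obtain ⟨e, l, h, he⟩ := exists_edgeList_eq_cons c.path c.isCycle.1
  exact ⟨e, by simp [h], Or.inl he.symm⟩

theorem toCycleSet_le_iff {c d : BasedCycle V} :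
    c.toCycleSet ≤ d.toCycleSet ↔ Nonempty (Path d.base c.base) := by
  refine ⟨?_, fun h => ⟨_, c.base_mem_support, _, d.base_mem_support, h⟩⟩
  rintro ⟨w, hw, x, hx, ⟨p⟩⟩
  obtain ⟨q⟩ := CycleSet.path_of_mem_support _ d.base_mem_support hx
  obtain ⟨r⟩ := CycleSet.path_of_mem_support _ hw c.base_mem_support
  exact ⟨(q.comp p).comp r⟩

/-- Walking `p` backwards, each edge must be the last edge of the current cycle by `edge_eq`, so
rotation moves the base to its source. -/
theorem exists_equiv_of_path (hV : HasDisjointCycles V) {a b : V} (p : Path a b) (q : Path b a)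
    (c : BasedCycle V) (hc : c.base = b) : ∃ d : BasedCycle V, d.base = a ∧ d ≈ c := by
  induction p generalizing c with
  | nil => exact ⟨c, hc, Setoid.refl c⟩
  | @cons x y p e ih =>
    obtain ⟨base, path, hcyc⟩ := c
    cases hc
    cases path with
    | nil => exact absurd hcyc.1 (by simp)
    | cons r f =>
      have hef := hV.edge_eq e f (q.comp p) r
      cases hef
      obtain ⟨d, hd, hdc⟩ := exists_rotation ⟨base, r.cons f, hcyc⟩
        (e := ⟨_, _, f⟩) (by simp [edgeList])
      obtain ⟨d', hd', hdc'⟩ := ih (f.toPath.comp q) d hd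
      exact ⟨d', hd', Setoid.trans hdc' hdc⟩

theorem toCycleSet_eq (hV : HasDisjointCycles V) {c d : BasedCycle V} (p : Path c.base d.base)
    (q : Path d.base c.base) : c.toCycleSet = d.toCycleSet := by
  obtain ⟨d', hd', hdd⟩ := exists_equiv_of_path hV p q d rfl
  rw [← show d'.toCycleSet = d.toCycleSet from Quotient.sound hdd]
  obtain ⟨a, r, hr⟩ := c
  obtain ⟨b, s, hs⟩ := d'
  cases hd'
  cases hV _ r s hr hs
  rfl

theorem path_of_equiv {c d : BasedCycle V} (h : c ≈ d) : Nonempty (Path c.base d.base) :=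
  toCycleSet_le_iff.1 (show c.toCycleSet = d.toCycleSet from Quotient.sound h).ge

end BasedCycle

/-! ### Counting paths by matrix powers -/

section Counting

/-- Removing the last edge of a path. -/
def pathSuccEquiv (a b : V) (k : ℕ) :
    {p : Path a b // p.length = k + 1} ≃
      Σ c : V, {p : Path a c // p.length = k} × (c ⟶ b) where
  toFun
    | ⟨Path.cons p e, h⟩ => ⟨_, ⟨p, Nat.succ.inj h⟩, e⟩
  invFun x := ⟨x.2.1.1.cons x.2.2, by simp [x.2.1.2]⟩
  left_inv := by
    rintro ⟨_ | ⟨p, e⟩, h⟩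
    · simp at h
    · rfl
  right_inv := by
    rintro ⟨c, ⟨p, h⟩, e⟩
    rfl

variable [Fintype V] [DecidableEq V] [∀ a b : V, Fintype (a ⟶ b)]

theorem finite_and_card_paths (a b : V) (k : ℕ) :
    Finite {p : Path a b // p.length = k} ∧
      Nat.card {p : Path a b // p.length = k} = (adjMatrix V ^ k) a b := by
  induction k generalizing b with
  | zero =>
    have hs : Subsingleton {p : Path a b // p.length = 0} := by
      constructor
      rintro ⟨p, hp⟩ ⟨q, hq⟩
      obtain rfl := Path.eq_of_length_zero p hp
      rw [Subtype.mk.injEq, Path.eq_nil_of_length_zero p hp, Path.eq_nil_of_length_zero q hq]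
    refine ⟨inferInstance, ?_⟩
    rw [pow_zero, Matrix.one_apply]
    split_ifs with h
    · subst h
      have : Nonempty {p : Path a a // p.length = 0} := ⟨⟨Path.nil, rfl⟩⟩
      exact Nat.card_unique
    · have : IsEmpty {p : Path a b // p.length = 0} :=
        ⟨fun p => h (Path.eq_of_length_zero p.1 p.2)⟩
      exact Nat.card_of_isEmpty
  | succ k ih =>
    have (c : V) : Finite {p : Path a c // p.length = k} := (ih c).1
    refine ⟨Finite.of_equiv _ (pathSuccEquiv a b k).symm, ?_⟩
    rw [Nat.card_congr (pathSuccEquiv a b k), Nat.card_sigma, pow_succ, Matrix.mul_apply]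
    refine Finset.sum_congr rfl fun c _ => ?_
    rw [Nat.card_prod, (ih c).2, Nat.card_eq_fintype_card]
    rfl

theorem adjMatrix_pow_pos_iff {a b : V} {k : ℕ} :
    0 < (adjMatrix V ^ k) a b ↔ ∃ p : Path a b, p.length = k := by
  have := (finite_and_card_paths a b k).1
  rw [← (finite_and_card_paths a b k).2, Nat.card_pos_iff, and_iff_left this]
  exact nonempty_subtype

theorem hasDisjointCycles_iff_adjMatrix_pow_le_one :
    HasDisjointCycles V ↔ ∀ (k : ℕ) (a : V), (adjMatrix V ^ k) a a ≤ 1 := by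
  have key (k : ℕ) (a : V) : (adjMatrix V ^ k) a a ≤ 1 ↔
      Subsingleton {p : Path a a // p.length = k} := by
    have := (finite_and_card_paths a a k).1
    rw [← (finite_and_card_paths a a k).2, Finite.card_le_one_iff_subsingleton]
  simp only [key, hasDisjointCycles_iff]
  constructor
  · intro h k a
    exact ⟨fun p q => Subtype.ext (h a _ _ (p.2.trans q.2.symm))⟩
  · intro h a p q hpq
    have := (h q.length a).elim ⟨p, hpq⟩ ⟨q, rfl⟩
    exact congrArg Subtype.val this

end Counting

end Paths

/-! ### Shift equivalence of matrices -/

section ShiftEquivalence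

theorem matrix_mul_pos_iff {k m n : Type*} [Fintype m] (M : Matrix k m ℕ) (N : Matrix m n ℕ) (a : k) (b : n) :
    0 < (M * N) a b ↔ ∃ c, 0 < M a c ∧ 0 < N c b := by
  simp [Matrix.mul_apply, Finset.sum_pos_iff]

theorem mul_le_matrix_mul {k m n : Type*} [Fintype m] (M : Matrix k m ℕ) (N : Matrix m n ℕ) (a : k) (c : m)
    (b : n) : M a c * N c b ≤ (M * N) a b := by
  rw [Matrix.mul_apply]
  exact Finset.single_le_sum (f := fun c => M a c * N c b) (fun _ _ => Nat.zero_le _)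
    (Finset.mem_univ c)

variable {m n : Type*} [Fintype m] [DecidableEq m] [Fintype n] [DecidableEq n]

/-- The pair `(R, S)` is a shift equivalence of lag `l` from `A` to `B`. -/
structure IsShiftEquivalence (A : Matrix m m ℕ) (B : Matrix n n ℕ) (R : Matrix m n ℕ)
    (S : Matrix n m ℕ) (l : ℕ) : Prop where
  one_le : 1 ≤ l
  pow_left : A ^ l = R * S
  pow_right : B ^ l = S * R
  mul_left : A * R = R * B
  mul_right : S * A = B * S

/-- The indices `v` and `w` belong to corresponding strongly connected components. -/
def Linked (A : Matrix m m ℕ) (B : Matrix n n ℕ) (R : Matrix m n ℕ) (S : Matrix n m ℕ)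
    (v : m) (w : n) : Prop :=
  (∃ i : ℕ, 0 < (A ^ i * R : Matrix m n ℕ) v w) ∧
    ∃ j : ℕ, 0 < (B ^ j * S : Matrix n m ℕ) w v

theorem Linked.symm {A : Matrix m m ℕ} {B : Matrix n n ℕ} {R : Matrix m n ℕ}
    {S : Matrix n m ℕ} {v : m} {w : n} (h : Linked A B R S v w) : Linked B A S R w v :=
  ⟨h.2, h.1⟩

namespace IsShiftEquivalence

variable {A : Matrix m m ℕ} {B : Matrix n n ℕ} {R : Matrix m n ℕ} {S : Matrix n m ℕ} {l : ℕ}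

theorem symm (h : IsShiftEquivalence A B R S l) : IsShiftEquivalence B A S R l :=
  ⟨h.one_le, h.pow_right, h.pow_left, h.mul_right.symm, h.mul_left.symm⟩

theorem pow_mul_comm (h : IsShiftEquivalence A B R S l) (k : ℕ) : A ^ k * R = R * B ^ k := by
  induction k with
  | zero => simp
  | succ k ih => rw [pow_succ, Matrix.mul_assoc, h.mul_left, ← Matrix.mul_assoc, ih,
      Matrix.mul_assoc, pow_succ]

theorem pow_eq (h : IsShiftEquivalence A B R S l) {N : ℕ} (hN : l ≤ N) :
    A ^ N = R * B ^ (N - l) * S := by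
  rw [← h.pow_mul_comm, Matrix.mul_assoc, ← h.pow_left, ← pow_add, Nat.sub_add_cancel hN]

/-- An entry at least 2 doubles with each repetition of the exponent `k`, against a bound on `(A ^
N) v v` independent of `N`. -/
theorem diag_le_one (h : IsShiftEquivalence A B R S l) (hB : ∀ k w, (B ^ k) w w ≤ 1)
    (k : ℕ) (v : m) : (A ^ k) v v ≤ 1 := by
  by_contra! hk
  have hpow (t : ℕ) : 2 ^ t ≤ (A ^ (k * t)) v v := by
    induction t with
    | zero => simp
    | succ t ih =>
      rw [Nat.mul_succ, pow_add A, pow_succ]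
      exact (Nat.mul_le_mul ih hk).trans (mul_le_matrix_mul _ _ _ _ _)
  have hbound (N : ℕ) (hN : l ≤ N) : (A ^ N) v v ≤ ∑ w', ∑ w, R v w * S w' v := by
    rw [h.pow_eq hN, Matrix.mul_apply]
    refine Finset.sum_le_sum fun w' _ => ?_
    rw [Matrix.mul_apply, Finset.sum_mul]
    refine Finset.sum_le_sum fun w _ => ?_
    rcases Nat.eq_zero_or_pos (R v w) with hR | hR
    · simp [hR]
    rcases Nat.eq_zero_or_pos (S w' v) with hS | hS
    · simp [hS]
    -- Passing through `v` leads from `w'` back to `w`, so the entry of `B ^ (N - l)` at `(w, w')`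
    -- is dominated by a diagonal entry.
    have h₁ : 0 < (B ^ l) w' w := by
      rw [h.pow_right, matrix_mul_pos_iff]
      exact ⟨v, hS, hR⟩
    have h₂ : (B ^ (N - l)) w w' ≤ 1 := by
      calc (B ^ (N - l)) w w' ≤ (B ^ (N - l)) w w' * (B ^ l) w' w := Nat.le_mul_of_pos_right _ h₁
        _ ≤ (B ^ (N - l + l)) w w := by rw [pow_add]; exact mul_le_matrix_mul _ _ _ _ _
        _ ≤ 1 := hB _ _
    exact Nat.mul_le_mul_right _ (by simpa using Nat.mul_le_mul_left (R v w) h₂)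
  have hk0 : 0 < k := by
    rcases Nat.eq_zero_or_pos k with rfl | hk0
    · simp at hk
    · exact hk0
  set C := ∑ w', ∑ w, R v w * S w' v
  -- The summand `l` makes the exponent at least `l`, and `2 ^ (l + C)` exceeds `C`.
  have h₁ := hpow (l + C)
  have h₂ := hbound (k * (l + C)) ((Nat.le_add_right l C).trans (Nat.le_mul_of_pos_left _ hk0))
  have h₃ := Nat.lt_two_pow_self (n := l + C)
  omega

/-- A path in one graph is carried to the other one, its length changing by a constant. -/
theorem pow_pos_of_pow_pos (h : IsShiftEquivalence A B R S l) {v v' : m} {w w' : n}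
    (hl : Linked A B R S v w) (hl' : Linked A B R S v' w') :
    ∃ t, 1 ≤ t ∧ ∀ k, 0 < (A ^ k) v v' → 0 < (B ^ (k + t)) w w' := by
  obtain ⟨-, j, hj⟩ := hl
  obtain ⟨⟨i, hi⟩, -⟩ := hl'
  refine ⟨i + j + l, by have := h.one_le; omega, fun k hk => ?_⟩
  -- The route goes from `w` to `v` by `B ^ j * S`, on to `v'` by `A ^ k`, and to `w'` by `A ^ i *
  -- R`; the product `S * R` contributes the lag `l`.
  have key : B ^ (k + (i + j + l)) = B ^ j * S * (A ^ k * (A ^ i * R)) := by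
    rw [← Matrix.mul_assoc (A ^ k), ← pow_add, h.pow_mul_comm, ← Matrix.mul_assoc,
      Matrix.mul_assoc (B ^ j), ← h.pow_right, ← pow_add, ← pow_add]
    congr 1
    omega
  rw [key, matrix_mul_pos_iff]
  refine ⟨v, hj, ?_⟩
  rw [matrix_mul_pos_iff]
  exact ⟨v', hk, hi⟩

/-- Repeating the return to `v` `l` times makes the exponent at least `l`; the walk then factors
through `R`, and the index reached there is linked to `v`. -/
theorem exists_linked (h : IsShiftEquivalence A B R S l) {v : m} {k : ℕ} (hk : 1 ≤ k)
    (hv : 0 < (A ^ k) v v) : ∃ w, Linked A B R S v w := by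
  have hpow (t : ℕ) : 0 < (A ^ (k * t)) v v := by
    induction t with
    | zero => simp
    | succ t ih =>
      rw [Nat.mul_succ, pow_add, matrix_mul_pos_iff]
      exact ⟨v, ih, hv⟩
  have hv' := hpow l
  rw [h.pow_eq (Nat.le_mul_of_pos_left _ hk), Matrix.mul_assoc, matrix_mul_pos_iff] at hv'
  obtain ⟨w, hR, hS⟩ := hv'
  exact ⟨w, ⟨0, by simpa using hR⟩, _, hS⟩

end IsShiftEquivalence

end ShiftEquivalence

/-! ### The correspondence between cycles -/

section CycleCorrespondence

open Quiver

variable {V : Type u} [Quiver.{v} V] [Fintype V] [DecidableEq V] [∀ a b : V, Fintype (a ⟶ b)]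
  {W : Type u'} [Quiver.{v'} W] [Fintype W] [DecidableEq W] [∀ a b : W, Fintype (a ⟶ b)]
  {R : Matrix V W ℕ} {S : Matrix W V ℕ} {l : ℕ}

namespace IsShiftEquivalence

theorem hasDisjointCycles (h : IsShiftEquivalence (adjMatrix V) (adjMatrix W) R S l)
    (hW : HasDisjointCycles W) : HasDisjointCycles V :=
  hasDisjointCycles_iff_adjMatrix_pow_le_one.2
    (h.diag_le_one (hasDisjointCycles_iff_adjMatrix_pow_le_one.1 hW))

theorem nonempty_path (h : IsShiftEquivalence (adjMatrix V) (adjMatrix W) R S l) {a a' : V}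
    {b b' : W} (hl : Linked (adjMatrix V) (adjMatrix W) R S a b)
    (hl' : Linked (adjMatrix V) (adjMatrix W) R S a' b') (p : Path a a') :
    Nonempty (Path b b') := by
  obtain ⟨t, -, ht⟩ := h.pow_pos_of_pow_pos hl hl'
  obtain ⟨q, -⟩ := adjMatrix_pow_pos_iff.1 (ht _ (adjMatrix_pow_pos_iff.2 ⟨p, rfl⟩))
  exact ⟨q⟩

theorem exists_linked_basedCycle (h : IsShiftEquivalence (adjMatrix V) (adjMatrix W) R S l)
    (c : BasedCycle V) :
    ∃ d : BasedCycle W, Linked (adjMatrix V) (adjMatrix W) R S c.base d.base := by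
  obtain ⟨w, hw⟩ := h.exists_linked c.isCycle.1 (adjMatrix_pow_pos_iff.2 ⟨c.path, rfl⟩)
  obtain ⟨t, ht, hp⟩ := h.pow_pos_of_pow_pos hw hw
  -- The empty path at `c.base` becomes a closed path at `w` of length `t`, positive by `ht`.
  obtain ⟨p, hp⟩ := adjMatrix_pow_pos_iff.1 (hp 0 (by simp))
  obtain ⟨d, rfl⟩ := exists_basedCycle p (by omega)
  exact ⟨d, hw⟩

/-- The empty path and `c` transport to closed paths of lengths `t` and `c.path.length + t`, both
multiples of the length of `d`. -/
theorem length_dvd (h : IsShiftEquivalence (adjMatrix V) (adjMatrix W) R S l)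
    (hW : HasDisjointCycles W) {c : BasedCycle V} {d : BasedCycle W}
    (hl : Linked (adjMatrix V) (adjMatrix W) R S c.base d.base) :
    d.path.length ∣ c.path.length := by
  obtain ⟨t, -, ht⟩ := h.pow_pos_of_pow_pos hl hl
  obtain ⟨p, hp⟩ := adjMatrix_pow_pos_iff.1 (ht 0 (by simp))
  obtain ⟨q, hq⟩ := adjMatrix_pow_pos_iff.1 (ht _ (adjMatrix_pow_pos_iff.2 ⟨c.path, rfl⟩))
  have h₁ := hW.length_dvd d.isCycle p
  have h₂ := hW.length_dvd d.isCycle q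
  rw [hp, zero_add] at h₁
  rw [hq] at h₂
  exact (Nat.dvd_add_left h₁).1 h₂

/-- Cycles based at linked vertices correspond to each other. -/
theorem exists_orderIso (h : IsShiftEquivalence (adjMatrix V) (adjMatrix W) R S l)
    (hV : HasDisjointCycles V) (hW : HasDisjointCycles W) :
    ∃ φ : CycleSet V ≃o CycleSet W, ∀ c, (φ c).length = c.length := by
  choose f hf using h.exists_linked_basedCycle
  choose g hg using h.symm.exists_linked_basedCycle
  let φ (c : CycleSet V) : CycleSet W := (f (Quotient.out c)).toCycleSet
  let ψ (d : CycleSet W) : CycleSet V := (g (Quotient.out d)).toCycleSet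
  have hψφ : Function.LeftInverse ψ φ := by
    intro c
    -- The chosen representative may be a rotation of `f (Quotient.out c)`; paths between the two
    -- bases, carried back to `V`, put both cycles in one component.
    have he : Quotient.out (φ c) ≈ f (Quotient.out c) := Quotient.mk_out _
    obtain ⟨p⟩ := BasedCycle.path_of_equiv he
    obtain ⟨q⟩ := BasedCycle.path_of_equiv (Setoid.symm he)
    obtain ⟨p'⟩ := h.symm.nonempty_path (hg _) (hf _).symm p
    obtain ⟨q'⟩ := h.symm.nonempty_path (hf _).symm (hg _) q
    exact (BasedCycle.toCycleSet_eq hV p' q').trans (Quotient.out_eq c)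
  have hφψ : Function.RightInverse ψ φ := by
    intro d
    have he : Quotient.out (ψ d) ≈ g (Quotient.out d) := Quotient.mk_out _
    obtain ⟨p⟩ := BasedCycle.path_of_equiv he
    obtain ⟨q⟩ := BasedCycle.path_of_equiv (Setoid.symm he)
    obtain ⟨p'⟩ := h.nonempty_path (hf _) (hg _).symm p
    obtain ⟨q'⟩ := h.nonempty_path (hg _).symm (hf _) q
    exact (BasedCycle.toCycleSet_eq hW p' q').trans (Quotient.out_eq d)
  refine ⟨⟨⟨φ, ψ, hψφ, hφψ⟩, ?_⟩, fun c => ?_⟩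
  · intro c d
    change φ c ≤ φ d ↔ c ≤ d
    have hout (c : CycleSet V) : (Quotient.out c).toCycleSet = c := Quotient.out_eq c
    have hle : c ≤ d ↔ Nonempty (Path (Quotient.out d).base (Quotient.out c).base) := by
      rw [← BasedCycle.toCycleSet_le_iff, hout, hout]
    refine BasedCycle.toCycleSet_le_iff.trans (Iff.trans ?_ hle.symm)
    exact ⟨fun ⟨p⟩ => h.symm.nonempty_path (hf _).symm (hf _).symm p,
      fun ⟨p⟩ => h.nonempty_path (hf _) (hf _) p⟩
  · conv_rhs => rw [← Quotient.out_eq c]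
    exact Nat.dvd_antisymm (h.length_dvd hW (hf _)) (h.symm.length_dvd hV (hf _).symm)

end IsShiftEquivalence

end CycleCorrespondence

end GraphCycles

theorem theorem3p2
    {V : Type*} [Quiver V] [Fintype V] [DecidableEq V] [∀ a b : V, Fintype (a ⟶ b)]
    {W : Type*} [Quiver W] [Fintype W] [DecidableEq W] [∀ a b : W, Fintype (a ⟶ b)]
    (hV : GraphCycles.IsEssential V) (hW : GraphCycles.IsEssential W)
    (h : GraphCycles.ShiftEquivalent (GraphCycles.adjMatrix V) (GraphCycles.adjMatrix W)) :
    (GraphCycles.HasDisjointCycles V ↔ GraphCycles.HasDisjointCycles W) ∧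
      (GraphCycles.HasDisjointCycles V →
        ∃ φ : GraphCycles.CycleSet V ≃o GraphCycles.CycleSet W,
          ∀ c : GraphCycles.CycleSet V, (φ c).length = c.length) := by
  obtain ⟨l, hl, R, S, h₁, h₂, h₃, h₄⟩ := h
  have h : GraphCycles.IsShiftEquivalence _ _ R S l := ⟨hl, h₁, h₂, h₃, h₄⟩
  exact ⟨⟨h.symm.hasDisjointCycles, h.hasDisjointCycles⟩,
    fun hd => h.exists_orderIso hd (h.symm.hasDisjointCycles hd)⟩
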